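/- **Setting.** Let $Q,K\in\mathbb R^{n\times d_{kq}}$, $V\in\mathbb R^{n\times d_v}$, $u\in\mathbb R^{d_v}$, and let $f_1,\dots,f_n:\mathbb R\to\mathbb R$ be non-decreasing. For $S\subseteq[n]$ let $X_S\in\{0,1\}^{n\times n}$ be the diagonal matrix with $(X_S)_{ii}=1$ iff $i\in S$, and let $$\mathrm{SA}(X_S)=\mathrm{softmax}\big((X_SQ)(X_SK)^\top\big)\,X_SV .$$ Problem (Main) with budget $k$ is to maximize $\sum_{i\in S} f_i\big(\mathrm{SA}(X_S)_i^\top u\big)$ over $S\subseteq[n]$, $|S|\le k$; its optimal value is denoted $\mathrm{OPT}$. The row-wise softmax is normalized either over all $n$ columns (so that each $j\notin S$ contributes $\exp(0)=1$), or over the columns $j\in S$ only (so that row $i\in S$ is a weighted average of the value vectors of $S$). The result below holds for each of these two conventions. Graphs are simple with vertex set $\{1,\dots,n-1\}$, $n\ge 2$; vertex $v$ corresponds to item $v$, and item $n$ is extra. **(a)** *If $d_{kq}=n$ and $k\ge4$, Problem (Main) subsumes the $(k-1)$-Clique problem on graphs with $n-1$ vertices.* Precisely: there are a number $d_v$ and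 five fixed formulas, independent of $n$, $k$ and the graph and built from rational constants by $+$, $\times$ and case distinctions "if $s\le t$ then … else …", such that for all $n\ge2$, $k\ge4$ and every graph $G$ on $n-1$ vertices the following holds. There is an instance of Problem (Main) with $n$ items, budget $k$ and $d_{kq}=n$ in which each entry $Q_{ij}$ and each entry $K_{ij}$ is the value of its formula at $n,k,i,j$ and the adjacency bit of $(i,j)$ in $G$ (the bit is $0$ if $i=n$ or $j=n$), while $V_{ij}$, $u_j$ and $f_i(x)$ are the values of their formulas at $(n,k,i,j)$, $(n,k,j)$ and $(n,k,i,x)$ respectively and do not depend on $G$. (So the instance is written down in $O(n^2)$ arithmetic operations.) This instance has $\mathrm{OPT}>0$. If $G$ has a clique of size $k-1$, then $\mathrm{OPT}=k-1$ and for every optimal $S$ the set $S\setminus\{n\}$ is a clique of size $k-1$ in $G$. If $G$ has no such clique, then $\mathrm{OPT}<k-1$. **(b)** For every real $M\ge3$ there is $c=c(M)>0$ such that for all $n$, $d_{kq}$, $k$ with $\exp(c\,d_{kq})\le n-1$ and $k\ge M+1$, *Problem (Main) subsumes finding a largest clique in a graph with $n-1$ vertices made of $\exp(c\,d_{kq})$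 disjoint cliques of sizes between $k-M$ and $k-1$.* Precisely: for every integer $0\le\ell\le\exp(c\,d_{kq})$ there are $d_v$, $V$, $u$, non-decreasing $f_1,\dots,f_n$, and two tables assigning a query vector and a key vector in $\mathbb R^{d_{kq}}$ to each label in $\{1,\dots,\ell\}$ and to the extra item, all chosen before the graph is given, such that the following holds. Let $G$ be any graph on $n-1$ vertices that is the disjoint union of $\ell$ cliques labelled $1,\dots,\ell$ (two distinct vertices are adjacent iff their labels agree), each of size at least $k-M$ and at most $k-1$. Consider the instance of Problem (Main) with this $V,u,f_1,\dots,f_n$ and budget $k$ in which the query and key vectors of each vertex item are looked up at the label of its clique, and those of item $n$ are the ones assigned to the extra item. It has $\mathrm{OPT}>0$, and for every optimal $S$ the set $S\setminus\{n\}$ is a largest clique of $G$ and $\mathrm{OPT}=|S\setminus\{n\}|$. -/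

import Mathlib

open scoped Matrix

noncomputable section

namespace SimpleTransformer

/-! ## Simple transformers and Problem (Main) -/

/-- Row-wise softmax with the normalisation taken over the columns in `J` (weight `0` outside `J`).
For `J = univ` this is the usual softmax `exp (A i j) / ∑ l, exp (A i l)`. -/
def softmaxOn {n : ℕ} (J : Finset (Fin n)) (A : Matrix (Fin n) (Fin n) ℝ) :
    Matrix (Fin n) (Fin n) ℝ :=
  Matrix.of fun i j => if j ∈ J then Real.exp (A i j) / ∑ l ∈ J, Real.exp (A i l) else 0

/-- The set-membership matrix `X_S`. -/
def membership {n : ℕ} (S : Finset (Fin n)) : Matrix (Fin n) (Fin n) ℝ :=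
  Matrix.diagonal fun i => if i ∈ S then 1 else 0

/-- The two conventions for evaluating a self-attention layer on a set `S` of items.
`zeroed`: the softmax of `(X_S Q)(X_S K)ᵀ` runs over all `n` columns, so that every `j ∉ S` still
contributes `exp 0 = 1` to the normalisation.
`restricted`: the softmax runs over the columns in `S` only, so that the output is a weighted
average of the value vectors of the items in `S`. -/
inductive Masking
  | zeroed
  | restricted

/-- The columns over which the softmax is normalised. -/
def Masking.columns (mode : Masking) {n : ℕ} (S : Finset (Fin n)) : Finset (Fin n) :=
  match mode with
  | .zeroed => Finset.univ
  | .restricted => S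

/-- The self-attention layer evaluated at the set `S`:
`softmax ((X_S Q) (X_S K)ᵀ) (X_S V)`. -/
def selfAttention (mode : Masking) {n d dv : ℕ} (Q K : Matrix (Fin n) (Fin d) ℝ)
    (V : Matrix (Fin n) (Fin dv) ℝ) (S : Finset (Fin n)) : Matrix (Fin n) (Fin dv) ℝ :=
  softmaxOn (mode.columns S) ((membership S * Q) * (membership S * K)ᵀ) * (membership S * V)

/-- The data of Problem (Main), apart from the budget `k`: query, key and value matrices, a user
vector, and non-decreasing reward functions. -/
structure Instance (n d dv : ℕ) where
  Q : Matrix (Fin n) (Fin d) ℝ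
  K : Matrix (Fin n) (Fin d) ℝ
  V : Matrix (Fin n) (Fin dv) ℝ
  u : Fin dv → ℝ
  f : Fin n → ℝ → ℝ
  monotone_f : ∀ i, Monotone (f i)

/-- The objective `∑ i ∈ S, f i (SA(X_S)_i · u)` of Problem (Main). -/
def Instance.objective (mode : Masking) {n d dv : ℕ} (T : Instance n d dv) (S : Finset (Fin n)) :
    ℝ :=
  ∑ i ∈ S, T.f i (selfAttention mode T.Q T.K T.V S i ⬝ᵥ T.u)

/-- `S` is an optimal solution of Problem (Main) with budget `k`. -/
def Instance.IsOptimal (mode : Masking) {n d dv : ℕ} (T : Instance n d dv) (k : ℕ)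
    (S : Finset (Fin n)) : Prop :=
  S.card ≤ k ∧ ∀ S' : Finset (Fin n), S'.card ≤ k → T.objective mode S' ≤ T.objective mode S

/-- The standing assumption `OPT > 0`. -/
def Instance.OptPos (mode : Masking) {n d dv : ℕ} (T : Instance n d dv) (k : ℕ) : Prop :=
  ∃ S : Finset (Fin n), S.card ≤ k ∧ 0 < T.objective mode S

/-! ## Reading a vertex set off a solution

The graphs have vertices `Fin m`; the items are `Fin (m + 1)`, i.e. `n = m + 1`. The vertex `v` is
the item `v.castSucc`, and `Fin.last m` is the one additional item. -/

/-- The vertices among the items of `S` (i.e. `S` without the additional item). -/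
def vertices {m : ℕ} (S : Finset (Fin (m + 1))) : Finset (Fin m) :=
  Finset.univ.filter fun v => v.castSucc ∈ S

/-- Every optimal solution of Problem (Main) on `T` solves the `(k-1)`-clique problem on `G`: if
there is a `(k-1)`-clique then the optimal value is `k-1` and the vertices selected form such a
clique; otherwise the optimal value is less than `k-1`. -/
def SolvesClique (mode : Masking) {m d dv : ℕ} (T : Instance (m + 1) d dv) (k : ℕ)
    (G : SimpleGraph (Fin m)) : Prop :=
  ∀ S, T.IsOptimal mode k S →
    ((∃ C, G.IsNClique (k - 1) C) →
      T.objective mode S = (k : ℝ) - 1 ∧ G.IsNClique (k - 1) (vertices S)) ∧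
    ((¬ ∃ C, G.IsNClique (k - 1) C) → T.objective mode S < (k : ℝ) - 1)

/-- Every optimal solution of Problem (Main) on `T` yields a largest clique of `G`, and the optimal
value is the size of that clique. -/
def SolvesMaxClique (mode : Masking) {m d dv : ℕ} (T : Instance (m + 1) d dv) (k : ℕ)
    (G : SimpleGraph (Fin m)) : Prop :=
  ∀ S, T.IsOptimal mode k S →
    (∀ C : Finset (Fin m), G.IsClique (C : Set (Fin m)) → C.card ≤ (vertices S).card) ∧
    G.IsClique (vertices S : Set (Fin m)) ∧
    T.objective mode S = ((vertices S).card : ℝ)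

/-! ## Uniform, constant-time reductions

A reduction to Problem (Main) has to be effective: an arbitrary map from graphs to instances could
hide the answer in the instance. Here every number of the instance is the value of one *fixed*
arithmetic formula, the same for all sizes, budgets and graphs, which sees one adjacency bit.
The whole instance with `d_kq = n` is thus written down in `O(n ^ 2)` arithmetic operations. -/

/-- The quantities which a formula may use: the number of items `n`, the budget `k`, a row index
`i` and a column index `j` (counted from `1`), one adjacency bit, and a real argument `x`. -/
inductive Var
  | n
  | k
  | i
  | j
  | bit
  | x

/-- Loop-free arithmetic formulas: rational constants, sums, products and case distinctions. -/
inductive Formula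
  | var (v : Var)
  | const (q : ℚ)
  | add (s t : Formula)
  | mul (s t : Formula)
  | ifLe (a b s t : Formula)

/-- The value of a formula; `ifLe a b s t` is `s` if `a ≤ b`, and `t` otherwise. -/
def Formula.eval (env : Var → ℝ) : Formula → ℝ
  | .var v => env v
  | .const q => (q : ℝ)
  | .add s t => s.eval env + t.eval env
  | .mul s t => s.eval env * t.eval env
  | .ifLe a b s t => if a.eval env ≤ b.eval env then s.eval env else t.eval env

/-- The assignment of values to the variables. -/
def env (n k i j bit x : ℝ) : Var → ℝ
  | .n => n
  | .k => k
  | .i => i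
  | .j => j
  | .bit => bit
  | .x => x

open Classical in
/-- The adjacency bit of two items: `1` if both are vertices and they are adjacent, else `0`. -/
def adjBit {m : ℕ} (G : SimpleGraph (Fin m)) (i j : Fin (m + 1)) : ℝ :=
  if ∃ v w : Fin m, v.castSucc = i ∧ w.castSucc = j ∧ G.Adj v w then 1 else 0

/-- Five formulas, one for the entries of each part of an instance. -/
structure Program where
  Q : Formula
  K : Formula
  V : Formula
  u : Formula
  f : Formula

/-- `T` is what the program `P` writes down for the graph `G` and the budget `k`, with `d_kq = n`.
An entry of `Q` or `K` is computed from `n`, `k`, its position, and the adjacency bit at that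
position; `V`, `u` and the reward functions do not depend on the graph. -/
structure Program.Outputs (P : Program) {m dv : ℕ} (k : ℕ) (G : SimpleGraph (Fin m))
    (T : Instance (m + 1) (m + 1) dv) : Prop where
  Q : ∀ i j, T.Q i j =
    P.Q.eval (env ((m : ℝ) + 1) k ((i : ℕ) + 1) ((j : ℕ) + 1) (adjBit G i j) 0)
  K : ∀ i j, T.K i j =
    P.K.eval (env ((m : ℝ) + 1) k ((i : ℕ) + 1) ((j : ℕ) + 1) (adjBit G i j) 0)
  V : ∀ i j, T.V i j = P.V.eval (env ((m : ℝ) + 1) k ((i : ℕ) + 1) ((j : ℕ) + 1) 0 0)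
  u : ∀ j, T.u j = P.u.eval (env ((m : ℝ) + 1) k 0 ((j : ℕ) + 1) 0 0)
  f : ∀ i x, T.f i x = P.f.eval (env ((m : ℝ) + 1) k ((i : ℕ) + 1) 0 0 x)

/-! ## Graphs made of disjoint cliques -/

/-- `G` is the disjoint union of the `l` cliques `lab ⁻¹ {a}`, each of which has size at least
`k - M` and at most `k - 1`. -/
structure IsDisjointCliques {m l : ℕ} (G : SimpleGraph (Fin m)) (lab : Fin m → Fin l) (k : ℕ)
    (M : ℝ) : Prop where
  adj_iff : ∀ v w, G.Adj v w ↔ v ≠ w ∧ lab v = lab w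
  le_card : ∀ a, (k : ℝ) - M ≤ ((Finset.univ.filter fun v => lab v = a).card : ℝ)
  card_le : ∀ a, ((Finset.univ.filter fun v => lab v = a).card : ℝ) ≤ (k : ℝ) - 1

/-- The clique in which an item lies (`none` for the additional item). -/
def itemLabel {m l : ℕ} (lab : Fin m → Fin l) : Fin (m + 1) → Option (Fin l) :=
  Fin.lastCases none fun v => some (lab v)

/-- The instance in which the query and key vectors of an item are looked up in two tables `q`, `κ`
indexed by cliques, and nothing else depends on the graph. -/
def tableInstance {m d dv l : ℕ} (q κ : Option (Fin l) → Fin d → ℝ)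
    (V : Matrix (Fin (m + 1)) (Fin dv) ℝ) (u : Fin dv → ℝ) (f : Fin (m + 1) → ℝ → ℝ)
    (hf : ∀ i, Monotone (f i)) (lab : Fin m → Fin l) : Instance (m + 1) d dv where
  Q := Matrix.of fun i => q (itemLabel lab i)
  K := Matrix.of fun i => κ (itemLabel lab i)
  V := V
  u := u
  f := f
  monotone_f := hf

end SimpleTransformer

end

/-!
The extra item is the only one with a nonzero value, so the attention which a vertex `v` of `S` pays
to it is the reciprocal of the softmax normalizer of row `v`. If all the scores of `v` within `S`
are nonpositive, each of the at most `n` columns contributes at most `1` and the normalizer is at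
most `n`; a single score `s ≥ n` makes it at least `exp s > n`. This holds under both masking
conventions. Rewarding `v` with `1` if the attention is at least `1 / n` and with `-n` otherwise,
one penalized vertex outweighs all rewards. So as soon as the scores are nonpositive along edges and
on the diagonal, and at least `n` in one direction between non-adjacent vertices, the sets with
positive objective value are exactly the nonempty cliques with the extra item added, and the value
is the size of the clique.

With keys forming the identity matrix, the scores are the query entries and can be read off the
adjacency matrix. For a disjoint union of cliques labelled `1, …, ℓ`, the scores `n * (b - a)`
between labels `a` and `b` are suitable, and dimension two is enough for any number of labels:
`b - a` is the dot product of `(-a, 1)` and `(1, b)`.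
-/

noncomputable section

namespace SimpleTransformer

open Finset

section Attention

variable {n d dv : ℕ} {mode : Masking} {Q K : Matrix (Fin n) (Fin d) ℝ} {S : Finset (Fin n)}
  {i j : Fin n}

lemma Masking.subset_columns (mode : Masking) (S : Finset (Fin n)) : S ⊆ mode.columns S := by
  cases mode
  · exact subset_univ S
  · exact Subset.refl S

lemma membership_mul_row (S : Finset (Fin n)) (A : Matrix (Fin n) (Fin d) ℝ) (i : Fin n) :
    (membership S * A) i = if i ∈ S then A i else 0 := by
  ext c
  split_ifs with hi <;> simp [membership, Matrix.diagonal_mul, hi]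

lemma masked_score (Q K : Matrix (Fin n) (Fin d) ℝ) (hi : i ∈ S) (j : Fin n) :
    ((membership S * Q) * (membership S * K)ᵀ) i j = if j ∈ S then Q i ⬝ᵥ K j else 0 := by
  change (membership S * Q) i ⬝ᵥ (membership S * K) j = _
  rw [membership_mul_row, membership_mul_row, if_pos hi]
  split_ifs
  · rfl
  · exact dotProduct_zero _

/-- The denominator of the softmax in row `i ∈ S` of the self-attention layer. -/
def normalizer (mode : Masking) (Q K : Matrix (Fin n) (Fin d) ℝ) (S : Finset (Fin n))
    (i : Fin n) : ℝ :=
  ∑ j ∈ mode.columns S, Real.exp (if j ∈ S then Q i ⬝ᵥ K j else 0)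

lemma exp_score_le_normalizer (hj : j ∈ S) :
    Real.exp (Q i ⬝ᵥ K j) ≤ normalizer mode Q K S i := by
  simpa only [normalizer, if_pos hj] using
    single_le_sum (f := fun j => Real.exp (if j ∈ S then Q i ⬝ᵥ K j else 0))
      (fun _ _ => (Real.exp_pos _).le) (mode.subset_columns S hj)

lemma normalizer_pos (hi : i ∈ S) : 0 < normalizer mode Q K S i :=
  (Real.exp_pos _).trans_le (exp_score_le_normalizer hi)

lemma lt_normalizer_of_le_score {r : ℝ} (hj : j ∈ S) (hr : r ≤ Q i ⬝ᵥ K j) :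
    r < normalizer mode Q K S i :=
  calc
    r < r + 1 := lt_add_one r
    _ ≤ Real.exp r := Real.add_one_le_exp r
    _ ≤ Real.exp (Q i ⬝ᵥ K j) := Real.exp_le_exp.2 hr
    _ ≤ normalizer mode Q K S i := exp_score_le_normalizer hj

lemma normalizer_le_of_score_nonpos (h : ∀ j ∈ S, Q i ⬝ᵥ K j ≤ 0) :
    normalizer mode Q K S i ≤ n :=
  calc
    normalizer mode Q K S i ≤ ∑ _j ∈ mode.columns S, (1 : ℝ) := by
      refine sum_le_sum fun j _ => Real.exp_le_one_iff.2 ?_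
      split_ifs with hj
      · exact h j hj
      · exact le_rfl
    _ = #(mode.columns S) := by rw [sum_const, nsmul_eq_mul, mul_one]
    _ ≤ n := by exact_mod_cast card_finset_fin_le (mode.columns S)

lemma selfAttention_dotProduct (V : Matrix (Fin n) (Fin dv) ℝ) (u : Fin dv → ℝ) (hi : i ∈ S) :
    selfAttention mode Q K V S i ⬝ᵥ u =
      (∑ j ∈ S, Real.exp (Q i ⬝ᵥ K j) * (V j ⬝ᵥ u)) / normalizer mode Q K S i := by
  set W := softmaxOn (mode.columns S) ((membership S * Q) * (membership S * K)ᵀ) with hW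
  have weight : ∀ j ∈ S, W i j = Real.exp (Q i ⬝ᵥ K j) / normalizer mode Q K S i := by
    intro j hj
    simp only [hW, softmaxOn, Matrix.of_apply, masked_score Q K hi, if_pos hj,
      if_pos (mode.subset_columns S hj), normalizer]
  calc
    selfAttention mode Q K V S i ⬝ᵥ u = ∑ j, W i j * ((membership S * V) j ⬝ᵥ u) :=
      congrFun (Matrix.mulVec_mulVec u W (membership S * V)).symm i
    _ = ∑ j ∈ S, W i j * (V j ⬝ᵥ u) := by
      simp only [membership_mul_row, apply_ite (· ⬝ᵥ u), zero_dotProduct, mul_ite, mul_zero,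
        sum_ite_mem, univ_inter]
    _ = _ := by
      rw [sum_div]
      exact sum_congr rfl fun j hj => by rw [weight j hj, div_mul_eq_mul_div]

end Attention

section Vertices

variable {m : ℕ} {S : Finset (Fin (m + 1))}

lemma mem_vertices {v : Fin m} : v ∈ vertices S ↔ v.castSucc ∈ S := by
  simp [vertices]

/-- The items given by the vertices in `C` and the additional item. -/
def withLast (C : Finset (Fin m)) : Finset (Fin (m + 1)) :=
  insert (Fin.last m) (C.map Fin.castSuccEmb)

lemma last_mem_withLast (C : Finset (Fin m)) : Fin.last m ∈ withLast C :=
  mem_insert_self _ _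

lemma castSucc_mem_withLast {C : Finset (Fin m)} {v : Fin m} :
    v.castSucc ∈ withLast C ↔ v ∈ C := by
  simp [withLast]

lemma vertices_withLast (C : Finset (Fin m)) : vertices (withLast C) = C := by
  ext v
  rw [mem_vertices, castSucc_mem_withLast]

lemma withLast_vertices (h : Fin.last m ∈ S) : withLast (vertices S) = S := by
  ext i
  cases i using Fin.lastCases with
  | last => exact iff_of_true (last_mem_withLast _) h
  | cast v => rw [castSucc_mem_withLast, mem_vertices]

lemma card_withLast (C : Finset (Fin m)) : #(withLast C) = #C + 1 := by
  rw [withLast, card_insert_of_notMem (by simp), card_map]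

end Vertices

section Detector

variable {m d : ℕ} {mode : Masking} {Q K : Matrix (Fin (m + 1)) (Fin d) ℝ}
  {S : Finset (Fin (m + 1))}

/-- The value vectors of a detector, of dimension one: only the additional item has a value. -/
def detectorValue (m : ℕ) : Matrix (Fin (m + 1)) (Fin 1) ℝ :=
  Matrix.of fun i _ => if i = Fin.last m then 1 else 0

/-- The reward functions of a detector: a vertex earns `1` if its attention to the additional item
is at least `1 / (m + 1)` and pays the penalty `m + 1` otherwise. -/
def detectorReward (m : ℕ) (i : Fin (m + 1)) (x : ℝ) : ℝ :=
  if i = Fin.last m then 0 else if 1 ≤ ((m : ℝ) + 1) * x then 1 else -((m : ℝ) + 1)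

lemma monotone_detectorReward (m : ℕ) (i : Fin (m + 1)) : Monotone (detectorReward m i) := by
  intro x y hxy
  have hm : (0 : ℝ) ≤ (m : ℝ) + 1 := by positivity
  have hmul : ((m : ℝ) + 1) * x ≤ ((m : ℝ) + 1) * y := mul_le_mul_of_nonneg_left hxy hm
  unfold detectorReward
  split_ifs <;> linarith

/-- The instance of Problem (Main) with queries `Q` and keys `K` in which a vertex is rewarded for
attending to the additional item, and penalized if other items distract it. -/
def detector (Q K : Matrix (Fin (m + 1)) (Fin d) ℝ) : Instance (m + 1) d 1 :=
  ⟨Q, K, detectorValue m, fun _ => 1, detectorReward m, monotone_detectorReward m⟩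

lemma detector_attention (hlast : ∀ v : Fin m, Q v.castSucc ⬝ᵥ K (Fin.last m) = 0) {v : Fin m}
    (hv : v.castSucc ∈ S) :
    selfAttention mode Q K (detectorValue m) S v.castSucc ⬝ᵥ (fun _ => 1) =
      if Fin.last m ∈ S then (normalizer mode Q K S v.castSucc)⁻¹ else 0 := by
  have value : ∀ j, detectorValue m j ⬝ᵥ (fun _ => 1) = if j = Fin.last m then 1 else 0 := by
    simp [detectorValue, dotProduct]
  rw [selfAttention_dotProduct _ _ hv]
  simp only [value, mul_ite, mul_one, mul_zero, sum_ite_eq', hlast, Real.exp_zero, ite_div,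
    zero_div, one_div]

lemma detectorReward_attention (hlast : ∀ v : Fin m, Q v.castSucc ⬝ᵥ K (Fin.last m) = 0)
    {v : Fin m} (hv : v.castSucc ∈ S) :
    detectorReward m v.castSucc
        (selfAttention mode Q K (detectorValue m) S v.castSucc ⬝ᵥ fun _ => 1) =
      if Fin.last m ∈ S ∧ normalizer mode Q K S v.castSucc ≤ (m : ℝ) + 1 then 1
      else -((m : ℝ) + 1) := by
  rw [detectorReward, if_neg (Fin.castSucc_ne_last v), detector_attention hlast hv]
  by_cases hl : Fin.last m ∈ S
  · simp only [hl, if_true, true_and, ← div_eq_mul_inv, one_le_div (normalizer_pos hv)]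
  · simp [hl]

lemma detector_objective (hlast : ∀ v : Fin m, Q v.castSucc ⬝ᵥ K (Fin.last m) = 0) :
    (detector Q K).objective mode S = ∑ v ∈ vertices S,
      if Fin.last m ∈ S ∧ normalizer mode Q K S v.castSucc ≤ (m : ℝ) + 1 then 1
      else -((m : ℝ) + 1) := by
  have reward_last : ∀ x, detectorReward m (Fin.last m) x = 0 := fun x => if_pos rfl
  simp only [Instance.objective, detector, vertices, sum_filter]
  rw [← univ_inter S, ← sum_ite_mem, Fin.sum_univ_castSucc, reward_last, ite_self, add_zero,
    univ_inter]
  exact sum_congr rfl fun v _ => ite_congr rfl (detectorReward_attention hlast) fun _ => rfl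

end Detector

lemma forall_of_sum_ite_pos {ι : Type*} {s : Finset ι} {p : ι → Prop} [DecidablePred p] {b : ℝ}
    (hb : #s ≤ b) (h : 0 < ∑ i ∈ s, if p i then 1 else -b) : ∀ i ∈ s, p i := by
  classical
  intro i hi
  by_contra hpi
  have hb₀ : 0 ≤ b := (Nat.cast_nonneg _).trans hb
  have rest : ∑ j ∈ s.erase i, (if p j then 1 else -b) ≤ (#s : ℝ) - 1 :=
    calc
      ∑ j ∈ s.erase i, (if p j then 1 else -b) ≤ ∑ _j ∈ s.erase i, (1 : ℝ) :=
        sum_le_sum fun j _ => by split_ifs <;> linarith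
      _ = (#s : ℝ) - 1 := by rw [sum_const, nsmul_eq_mul, mul_one, cast_card_erase_of_mem hi]
  rw [← add_sum_erase _ _ hi, if_neg hpi] at h
  linarith

section Cliques

variable {m d k : ℕ} {mode : Masking} {G : SimpleGraph (Fin m)}
  {Q K : Matrix (Fin (m + 1)) (Fin d) ℝ} {S : Finset (Fin (m + 1))} {C : Finset (Fin m)}

/-- The scores `Q i ⬝ᵥ K j` encode the graph `G`, in such a way that the attention of a vertex to
the additional item is low when a non-adjacent vertex is present. A non-adjacent pair need only be
visible from one of its two vertices. -/
structure EncodesGraph (G : SimpleGraph (Fin m)) (Q K : Matrix (Fin (m + 1)) (Fin d) ℝ) :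
    Prop where
  score_last : ∀ v : Fin m, Q v.castSucc ⬝ᵥ K (Fin.last m) = 0
  score_self_nonpos : ∀ v : Fin m, Q v.castSucc ⬝ᵥ K v.castSucc ≤ 0
  score_nonpos_of_adj : ∀ v w, G.Adj v w → Q v.castSucc ⬝ᵥ K w.castSucc ≤ 0
  le_score_of_not_adj : ∀ v w, v ≠ w → ¬ G.Adj v w →
    (m : ℝ) + 1 ≤ Q v.castSucc ⬝ᵥ K w.castSucc ∨ (m : ℝ) + 1 ≤ Q w.castSucc ⬝ᵥ K v.castSucc

namespace EncodesGraph

lemma normalizer_withLast_le (h : EncodesGraph G Q K) (hC : G.IsClique (C : Set (Fin m)))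
    {v : Fin m} (hv : v ∈ C) :
    normalizer mode Q K (withLast C) v.castSucc ≤ (m : ℝ) + 1 := by
  rw [← Nat.cast_add_one]
  refine normalizer_le_of_score_nonpos fun j hj => ?_
  cases j using Fin.lastCases with
  | last => exact (h.score_last v).le
  | cast w =>
    obtain rfl | hvw := eq_or_ne v w
    · exact h.score_self_nonpos v
    · exact h.score_nonpos_of_adj v w (hC hv (castSucc_mem_withLast.1 hj) hvw)

lemma isClique_of_normalizer_le (h : EncodesGraph G Q K)
    (hS : ∀ v ∈ vertices S, normalizer mode Q K S v.castSucc ≤ (m : ℝ) + 1) :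
    G.IsClique (vertices S : Set (Fin m)) := by
  have score_lt : ∀ v ∈ vertices S, ∀ w ∈ vertices S,
      ¬ (m : ℝ) + 1 ≤ Q v.castSucc ⬝ᵥ K w.castSucc := fun v hv w hw hle =>
    (hS v hv).not_gt (lt_normalizer_of_le_score (mem_vertices.1 hw) hle)
  intro v hv w hw hvw
  by_contra hadj
  exact (h.le_score_of_not_adj v w hvw hadj).elim (score_lt v hv w hw) (score_lt w hw v hv)

lemma objective_withLast (h : EncodesGraph G Q K) (hC : G.IsClique (C : Set (Fin m))) :
    (detector Q K).objective mode (withLast C) = #C := by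
  rw [detector_objective h.score_last, vertices_withLast,
    sum_congr rfl fun v hv => if_pos ⟨last_mem_withLast C, h.normalizer_withLast_le hC hv⟩,
    sum_const, nsmul_eq_mul, mul_one]

lemma exists_isClique_of_objective_pos (h : EncodesGraph G Q K)
    (hpos : 0 < (detector Q K).objective mode S) :
    ∃ C : Finset (Fin m), G.IsClique (C : Set (Fin m)) ∧ withLast C = S := by
  rw [detector_objective h.score_last] at hpos
  have card_le : (#(vertices S) : ℝ) ≤ (m : ℝ) + 1 := by
    exact_mod_cast (card_finset_fin_le (vertices S)).trans m.le_succ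
  have rewarded := forall_of_sum_ite_pos card_le hpos
  obtain ⟨v, hv⟩ : (vertices S).Nonempty := nonempty_of_sum_ne_zero hpos.ne'
  exact ⟨vertices S, h.isClique_of_normalizer_le fun v hv => (rewarded v hv).2,
    withLast_vertices (rewarded v hv).1⟩

lemma optPos (h : EncodesGraph G Q K) (hm : 0 < m) (hk : 2 ≤ k) :
    (detector Q K).OptPos mode k := by
  refine ⟨withLast {⟨0, hm⟩}, (card_withLast _).trans_le hk, ?_⟩
  rw [h.objective_withLast (by simp)]
  simp

lemma exists_isClique_of_isOptimal (h : EncodesGraph G Q K) (hm : 0 < m) (hk : 2 ≤ k)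
    (hS : (detector Q K).IsOptimal mode k S) :
    ∃ C : Finset (Fin m), withLast C = S ∧ G.IsClique (C : Set (Fin m)) ∧ #C < k ∧
      ∀ D : Finset (Fin m), G.IsClique (D : Set (Fin m)) → #D < k → #D ≤ #C := by
  obtain ⟨S₀, hS₀, hpos⟩ := h.optPos (mode := mode) hm hk
  obtain ⟨C, hC, rfl⟩ := h.exists_isClique_of_objective_pos (hpos.trans_le (hS.2 S₀ hS₀))
  refine ⟨C, rfl, hC, (card_withLast C).symm.trans_le hS.1, fun D hD hDk => ?_⟩
  have hle := hS.2 (withLast D) ((card_withLast D).trans_le hDk)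
  rw [h.objective_withLast hD, h.objective_withLast hC] at hle
  exact_mod_cast hle

theorem solvesClique (h : EncodesGraph G Q K) (hm : 0 < m) (hk : 2 ≤ k) :
    SolvesClique mode (detector Q K) k G := by
  intro S hS
  obtain ⟨C, rfl, hC, hCk, hmax⟩ := h.exists_isClique_of_isOptimal hm hk hS
  rw [vertices_withLast, h.objective_withLast hC, ← Nat.cast_pred (by lia)]
  refine ⟨fun ⟨D, hD⟩ => ?_, fun hno => ?_⟩
  · have hDC : #D ≤ #C := hmax D hD.isClique (by rw [hD.card_eq]; lia)
    have hcard : #C = k - 1 := le_antisymm (by lia) (hD.card_eq ▸ hDC)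
    exact ⟨congrArg _ hcard, hC, hcard⟩
  · have hcard : #C ≠ k - 1 := fun hcard => hno ⟨C, hC, hcard⟩
    exact_mod_cast (by lia : #C < k - 1)

end EncodesGraph

lemma card_lt_of_cliqueFree {V : Type*} {G : SimpleGraph V} {k : ℕ} (hG : G.CliqueFree k)
    {C : Finset V} (hC : G.IsClique (C : Set V)) : #C < k := by
  by_contra! hk
  exact hG.mono hk C ⟨hC, rfl⟩

lemma two_le_of_cliqueFree {V : Type*} {G : SimpleGraph V} {k : ℕ} (hG : G.CliqueFree k)
    (v : V) : 2 ≤ k :=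
  card_lt_of_cliqueFree hG (C := {v}) (by simp)

theorem EncodesGraph.solvesMaxClique (h : EncodesGraph G Q K) (hm : 0 < m)
    (hG : G.CliqueFree k) : SolvesMaxClique mode (detector Q K) k G := by
  intro S hS
  obtain ⟨C, rfl, hC, -, hmax⟩ :=
    h.exists_isClique_of_isOptimal hm (two_le_of_cliqueFree hG ⟨0, hm⟩) hS
  rw [vertices_withLast]
  exact ⟨fun D hD => hmax D hD (card_lt_of_cliqueFree hG hD), hC, h.objective_withLast hC⟩

end Cliques

section Program

variable {m : ℕ}

/-- Queries which, with the identity matrix for keys, encode the graph `G`. -/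
def cliqueQuery (G : SimpleGraph (Fin m)) : Matrix (Fin (m + 1)) (Fin (m + 1)) ℝ :=
  Matrix.of fun i j => if j = Fin.last m then 0 else if i = j then 0
    else ((m : ℝ) + 1) * (1 - adjBit G i j)

open Classical in
lemma cliqueQuery_castSucc (G : SimpleGraph (Fin m)) (v w : Fin m) :
    cliqueQuery G v.castSucc w.castSucc = if v = w ∨ G.Adj v w then 0 else (m : ℝ) + 1 := by
  by_cases hvw : v = w
  · simp [cliqueQuery, hvw]
  · by_cases hadj : G.Adj v w <;>
      simp [cliqueQuery, adjBit, Fin.castSucc_ne_last, hvw, hadj]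

lemma encodesGraph_cliqueQuery (G : SimpleGraph (Fin m)) : EncodesGraph G (cliqueQuery G) 1 := by
  have score : ∀ i j, cliqueQuery G i ⬝ᵥ (1 : Matrix _ _ ℝ) j = cliqueQuery G i j := by
    simp [dotProduct, Matrix.one_apply]
  refine ⟨fun v => ?_, fun v => ?_, fun v w h => ?_, fun v w hvw h => Or.inl ?_⟩ <;> rw [score]
  · exact if_pos rfl
  · rw [cliqueQuery_castSucc, if_pos (Or.inl rfl)]
  · rw [cliqueQuery_castSucc, if_pos (Or.inr h)]
  · rw [cliqueQuery_castSucc, if_neg (not_or.2 ⟨hvw, h⟩)]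

/-- The case distinction "if `a = b` then `s` else `t`" as a formula. -/
def Formula.ifEq (a b s t : Formula) : Formula :=
  .ifLe a b (.ifLe b a s t) t

lemma Formula.eval_ifEq (a b s t : Formula) (e : Var → ℝ) :
    (Formula.ifEq a b s t).eval e = if a.eval e = b.eval e then s.eval e else t.eval e := by
  simp only [ifEq, eval, le_antisymm_iff, ite_and]

/-- The program that writes down the detector with queries `cliqueQuery G` and the identity matrix
for keys. -/
def cliqueProgram : Program where
  Q := .ifEq (.var .j) (.var .n) (.const 0) (.ifEq (.var .i) (.var .j) (.const 0)
    (.mul (.var .n) (.add (.const 1) (.mul (.const (-1)) (.var .bit)))))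
  K := .ifEq (.var .i) (.var .j) (.const 1) (.const 0)
  V := .ifEq (.var .i) (.var .n) (.const 1) (.const 0)
  u := .const 1
  f := .ifEq (.var .i) (.var .n) (.const 0)
    (.ifLe (.const 1) (.mul (.var .n) (.var .x)) (.const 1) (.mul (.const (-1)) (.var .n)))

lemma index_eq_iff {n : ℕ} (i j : Fin n) : ((i : ℕ) : ℝ) + 1 = (j : ℕ) + 1 ↔ i = j := by
  rw [add_left_inj, Nat.cast_inj, Fin.ext_iff]

lemma index_eq_card_iff (i : Fin (m + 1)) : ((i : ℕ) : ℝ) + 1 = (m : ℝ) + 1 ↔ i = Fin.last m :=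
  index_eq_iff i (Fin.last m)

lemma cliqueProgram_outputs (k : ℕ) (G : SimpleGraph (Fin m)) :
    cliqueProgram.Outputs k G (detector (cliqueQuery G) 1) := by
  constructor <;> intros <;>
    simp only [cliqueProgram, Formula.eval_ifEq, Formula.eval, env, index_eq_iff,
      index_eq_card_iff, Rat.cast_zero, Rat.cast_one, Rat.cast_neg, neg_one_mul,
      ← sub_eq_add_neg] <;>
    rfl

end Program

section DisjointCliques

variable {m d l : ℕ}

lemma exists_dotProduct_eq_sub {ι : Type*} (h : 2 ≤ d ∨ Subsingleton ι) (x : ι → ℝ) :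
    ∃ q κ : Option ι → Fin d → ℝ, κ none = 0 ∧
      ∀ a b, q (some a) ⬝ᵥ κ (some b) = x b - x a := by
  obtain hd | _ := h
  · obtain ⟨d, rfl⟩ := Nat.exists_eq_add_of_le' hd
    refine ⟨fun o => o.elim 0 fun a => Fin.cons (-x a) (Fin.cons 1 0),
      fun o => o.elim 0 fun b => Fin.cons 1 (Fin.cons (x b) 0), rfl, fun a b => ?_⟩
    simp only [Option.elim, dotProduct, Fin.sum_univ_succ, Fin.cons_zero, Fin.cons_succ,
      Pi.zero_apply, mul_zero, sum_const_zero]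
    ring
  · refine ⟨0, 0, rfl, fun a b => ?_⟩
    rw [Subsingleton.elim a b, sub_self]
    exact zero_dotProduct _

lemma itemLabel_castSucc (lab : Fin m → Fin l) (v : Fin m) :
    itemLabel lab v.castSucc = some (lab v) :=
  Fin.lastCases_castSucc _

lemma itemLabel_last (lab : Fin m → Fin l) : itemLabel lab (Fin.last m) = none :=
  Fin.lastCases_last

lemma encodesGraph_of_labels {G : SimpleGraph (Fin m)} {lab : Fin m → Fin l}
    (hadj : ∀ v w, G.Adj v w ↔ v ≠ w ∧ lab v = lab w) {q κ : Option (Fin l) → Fin d → ℝ}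
    (hκ : κ none = 0) (hqκ : ∀ a b : Fin l, q (some a) ⬝ᵥ κ (some b) =
      ((m : ℝ) + 1) * (b : ℕ) - ((m : ℝ) + 1) * (a : ℕ)) :
    EncodesGraph G (Matrix.of fun i => q (itemLabel lab i))
      (Matrix.of fun i => κ (itemLabel lab i)) := by
  have le_score : ∀ {a b : Fin l}, a < b → (m : ℝ) + 1 ≤ q (some a) ⬝ᵥ κ (some b) := by
    intro a b hab
    have hab' : ((a : ℕ) : ℝ) + 1 ≤ (b : ℕ) := by exact_mod_cast hab
    rw [hqκ, ← mul_sub]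
    exact le_mul_of_one_le_right (by positivity) (by linarith)
  have score : ∀ v w : Fin m,
      q (itemLabel lab v.castSucc) ⬝ᵥ κ (itemLabel lab w.castSucc) =
        q (some (lab v)) ⬝ᵥ κ (some (lab w)) := fun v w => by
    rw [itemLabel_castSucc, itemLabel_castSucc]
  have score_eq_zero : ∀ {v w}, lab v = lab w →
      q (itemLabel lab v.castSucc) ⬝ᵥ κ (itemLabel lab w.castSucc) = 0 := fun {v w} h => by
    rw [score, h, hqκ, sub_self]
  refine ⟨fun v => ?_, fun v => (score_eq_zero rfl).le,
    fun v w h => (score_eq_zero ((hadj v w).1 h).2).le, fun v w hvw h => ?_⟩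
  · change q _ ⬝ᵥ κ (itemLabel lab (Fin.last m)) = 0
    rw [itemLabel_last, hκ, dotProduct_zero]
  · have hlab : lab v ≠ lab w := fun hlab => h ((hadj v w).2 ⟨hvw, hlab⟩)
    exact hlab.lt_or_gt.imp (fun hlt => (le_score hlt).trans_eq (score v w).symm)
      fun hlt => (le_score hlt).trans_eq (score w v).symm

lemma IsDisjointCliques.cliqueFree {G : SimpleGraph (Fin m)} {lab : Fin m → Fin l} {k : ℕ}
    {M : ℝ} (hG : IsDisjointCliques G lab k M) (hk : 0 < k) : G.CliqueFree k := by
  rintro C ⟨hC, rfl⟩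
  obtain ⟨v, hv⟩ := card_pos.1 hk
  have sub : C ⊆ univ.filter fun w => lab w = lab v := by
    intro w hw
    obtain rfl | hwv := eq_or_ne w v
    · simp
    · exact mem_filter.2 ⟨mem_univ w, ((hG.adj_iff w v).1 (hC hw hv hwv)).2⟩
  have hle : (#C : ℝ) ≤ #(univ.filter fun w => lab w = lab v) := by
    exact_mod_cast card_le_card sub
  linarith [hG.card_le (lab v)]

lemma two_le_or_le_one_of_le_exp (h : (l : ℝ) ≤ Real.exp (1 / 2 * d)) : 2 ≤ d ∨ l ≤ 1 := by
  by_contra! ⟨hd, hl⟩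
  have hd' : (d : ℝ) ≤ 1 := by exact_mod_cast Nat.le_of_lt_succ hd
  have hl' : (2 : ℝ) ≤ l := by exact_mod_cast hl
  have hlog : Real.log 2 ≤ 1 / 2 * d := (Real.log_le_iff_le_exp two_pos).2 (hl'.trans h)
  linarith [Real.log_two_gt_d9]

end DisjointCliques

end SimpleTransformer

end

open SimpleTransformer in
theorem mainTheorem5_general :
    (∃ (dv : ℕ) (P : Program), ∀ m k : ℕ, 1 ≤ m → 2 ≤ k → ∀ G : SimpleGraph (Fin m),
      ∃ T : Instance (m + 1) (m + 1) dv, P.Outputs k G T ∧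
        ∀ mode, T.OptPos mode k ∧ SolvesClique mode T k G) ∧
    (∀ m d l : ℕ, 1 ≤ m → 2 ≤ d ∨ l ≤ 1 →
      ∃ (dv : ℕ) (q κ : Option (Fin l) → Fin d → ℝ) (V : Matrix (Fin (m + 1)) (Fin dv) ℝ)
        (u : Fin dv → ℝ) (f : Fin (m + 1) → ℝ → ℝ) (hf : ∀ i, Monotone (f i)),
        ∀ (G : SimpleGraph (Fin m)) (lab : Fin m → Fin l) (k : ℕ),
          (∀ v w, G.Adj v w ↔ v ≠ w ∧ lab v = lab w) → G.CliqueFree k →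
            ∀ mode, (tableInstance q κ V u f hf lab).OptPos mode k ∧
              SolvesMaxClique mode (tableInstance q κ V u f hf lab) k G) := by
  refine ⟨⟨1, cliqueProgram, fun m k hm hk G => ?_⟩, fun m d l hm hdl => ?_⟩
  · have h := encodesGraph_cliqueQuery G
    exact ⟨detector (cliqueQuery G) 1, cliqueProgram_outputs k G,
      fun mode => ⟨h.optPos hm hk, h.solvesClique hm hk⟩⟩
  · obtain ⟨q, κ, hκ, hqκ⟩ := exists_dotProduct_eq_sub
      (hdl.imp_right Fin.subsingleton_iff_le_one.2) fun a : Fin l => ((m : ℝ) + 1) * (a : ℕ)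
    refine ⟨1, q, κ, detectorValue m, fun _ => 1, detectorReward m, monotone_detectorReward m,
      fun G lab k hadj hG mode => ?_⟩
    have h := encodesGraph_of_labels hadj hκ hqκ
    exact ⟨h.optPos hm (two_le_of_cliqueFree hG ⟨0, hm⟩), h.solvesMaxClique hm hG⟩

theorem mainTheorem5 (mode : SimpleTransformer.Masking) :
    (∃ (dv : ℕ) (P : SimpleTransformer.Program), ∀ (m k : ℕ), 1 ≤ m → 4 ≤ k →
      ∀ G : SimpleGraph (Fin m),
        ∃ T : SimpleTransformer.Instance (m + 1) (m + 1) dv,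
          P.Outputs k G T ∧ T.OptPos mode k ∧ SimpleTransformer.SolvesClique mode T k G) ∧
    (∀ M : ℝ, 3 ≤ M → ∃ c : ℝ, 0 < c ∧ ∀ m d k l : ℕ,
      Real.exp (c * d) ≤ m → M + 1 ≤ k → (l : ℝ) ≤ Real.exp (c * d) →
        ∃ (dv : ℕ) (q κ : Option (Fin l) → Fin d → ℝ)
          (V : Matrix (Fin (m + 1)) (Fin dv) ℝ) (u : Fin dv → ℝ) (f : Fin (m + 1) → ℝ → ℝ)
          (hf : ∀ i, Monotone (f i)),
          ∀ (G : SimpleGraph (Fin m)) (lab : Fin m → Fin l),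
            SimpleTransformer.IsDisjointCliques G lab k M →
              (SimpleTransformer.tableInstance q κ V u f hf lab).OptPos mode k ∧
              SimpleTransformer.SolvesMaxClique mode
                (SimpleTransformer.tableInstance q κ V u f hf lab) k G) := by
  obtain ⟨⟨dv, P, hP⟩, hcliques⟩ := mainTheorem5_general
  refine ⟨⟨dv, P, fun m k hm hk G => ?_⟩, fun M hM => ⟨1 / 2, one_half_pos,
    fun m d k l hm hk hl => ?_⟩⟩
  · obtain ⟨T, hT, hsolves⟩ := hP m k hm (by lia) G
    exact ⟨T, hT, hsolves mode⟩
  · have hm' : 0 < m := Nat.cast_pos.1 ((Real.exp_pos _).trans_le hm)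
    have hk' : 0 < k := Nat.cast_pos.1 ((by linarith : (0 : ℝ) < M + 1).trans_le hk)
    obtain ⟨dv, q, κ, V, u, f, hf, hsolves⟩ :=
      hcliques m d l hm' (SimpleTransformer.two_le_or_le_one_of_le_exp hl)
    exact ⟨dv, q, κ, V, u, f, hf, fun G lab hG =>
      hsolves G lab k hG.adj_iff (hG.cliqueFree hk') mode⟩
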